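/- Let $V$ be a finite-dimensional real vector space. A model on $V$ is a triple $\mathfrak M=(V,\varphi,R)$, where $\varphi$ is a nondegenerate symmetric bilinear form on $V$ and $R\in\otimes^4V^*$ is an algebraic curvature tensor: $R(x,y,z,w)=-R(y,x,z,w)=R(z,w,x,y)$ and $R(x,y,z,w)+R(x,z,w,y)+R(x,w,y,z)=0$. It is Riemannian if $\varphi$ is positive definite, and skew-Tsankov if $\mathcal R(x,y)\mathcal R(z,w)=\mathcal R(z,w)\mathcal R(x,y)$ for all $x,y,z,w\in V$, where $R(x,y,z,w)=\varphi(\mathcal R(x,y)z,w)$. A decomposition of $\mathfrak M$ of length $s$ is a direct sum $V=V_1\oplus\dots\oplus V_s\oplus U$ with $\dim V_i=2$ and $R|_U=0$, such that $\varphi(x,y)=0$ and $R(x,y,z,w)=0$ for all $z,w\in V$ whenever $x$ and $y$ lie in two different summands. Let $\mathfrak M_i=(V_i,\varphi|_{V_i},R|_{V_i})$; when $\varphi$ is positive definite, its sectional curvature is $\kappa_i=R(x,y,y,x)/(\varphi(x,x)\varphi(y,y)-\varphi(x,y)^2)$ for any basis $x,y$ of $V_i$. For $A\in GL(V)$ let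 $A^*\mathfrak M=(V,A^*\varphi,A^*R)$, where $A^*$ is precomposition with $A$ in every slot. For a subset of the tensors $\{\varphi,R\}$, forming a model space $\mathfrak M'$, the structure group $G_{\mathfrak M'}$ is the group of all $A\in GL(V)$ with $A^*\beta=\beta$ for each tensor $\beta$ of $\mathfrak M'$. A function $\alpha$ of models on $V$, with values in a set $K$, is an invariant of $\mathfrak M$ (relative to $\mathfrak M'$) if $\alpha(A^*\mathfrak M)=\alpha(\mathfrak M)$ for all $A\in G_{\mathfrak M'}$. **Theorem.** Let $\mathfrak M=(V,\varphi,R)$ be a Riemannian skew-Tsankov model. 1. $\mathfrak M$ has a decomposition $\mathfrak M=\bigoplus_{i=1}^s\mathfrak M_i\oplus\mathfrak K$, $\mathfrak K=(U,\varphi|_U,0)$, with $U=\ker R=\{v\in V: R(v,x,y,z)=0\text{ for all }x,y,z\in V\}$, and the length $s$ of a decomposition with $U=\ker R$ is determined by $\mathfrak M$. 2. Suppose that $\mathfrak M$ has a decomposition of length $s$, and let $F:\mathbb R^s\to K$ be any symmetric function, with values in an arbitrary set $K$. Then $F(\kappa_1,\dots,\kappa_s)$ is a well-defined function of Riemannian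 skew-Tsankov models: there is a function $\alpha$ of models on $V$ such that $\alpha(\mathfrak N)=F(\kappa_1,\dots,\kappa_s)$ for every Riemannian skew-Tsankov model $\mathfrak N$ on $V$ and every decomposition of $\mathfrak N$ of length $s$, where the $\kappa_i$ are the sectional curvatures of its two-dimensional summands. Every such function $\alpha$ is an invariant of $\mathfrak M$, relative to each of the four model spaces $\mathfrak M'$ formed by $V$ and a subset of the tensors $\{\varphi,R\}$. -/

import Mathlib

/-- Four-linear real-valued forms (contravariant tensors of degree four) on `V`, in curried form. -/
abbrev FourForm (V : Type*) [AddCommGroup V] [Module ℝ V] : Type _ :=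
  V →ₗ[ℝ] V →ₗ[ℝ] V →ₗ[ℝ] V →ₗ[ℝ] ℝ

/-- Algebraic curvature tensors. -/
structure IsAlgebraicCurvatureTensor {V : Type*} [AddCommGroup V] [Module ℝ V]
    (R : FourForm V) : Prop where
  antisymm : ∀ x y z w, R x y z w = -R y x z w
  pair_symm : ∀ x y z w, R x y z w = R z w x y
  bianchi : ∀ x y z w, R x y z w + R x z w y + R x w y z = 0

/-- A model space `(V, φ, R)`: a nondegenerate symmetric bilinear form `φ` and an algebraic
curvature tensor `R` on `V`. -/
structure CurvatureModel (V : Type*) [AddCommGroup V] [Module ℝ V] where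
  /-- the inner product -/
  metric : LinearMap.BilinForm ℝ V
  metric_symm : ∀ x y, metric x y = metric y x
  metric_nondegenerate : metric.Nondegenerate
  /-- the curvature tensor -/
  curv : FourForm V
  curv_algebraic : IsAlgebraicCurvatureTensor curv

/-- The tensors of a model space `(V, φ, R)`. -/
inductive TensorLabel
  | metric
  | curv

/-- The action of `A ∈ GL(V)` on bilinear forms by precomposition. -/
noncomputable def pullbackBilin {V : Type*} [AddCommGroup V] [Module ℝ V]
    (A : V ≃ₗ[ℝ] V) (b : LinearMap.BilinForm ℝ V) : LinearMap.BilinForm ℝ V :=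
  b.compl₁₂ (A : V →ₗ[ℝ] V) (A : V →ₗ[ℝ] V)

/-- The action of `A ∈ GL(V)` on four-linear forms by precomposition. -/
noncomputable def pullbackFour {V : Type*} [AddCommGroup V] [Module ℝ V]
    (A : V ≃ₗ[ℝ] V) (R : FourForm V) : FourForm V :=
  A.symm.arrowCongr (A.symm.arrowCongr (A.symm.arrowCongr
    (A.symm.arrowCongr (LinearEquiv.refl ℝ ℝ)))) R

theorem pullbackBilin_apply {V : Type*} [AddCommGroup V] [Module ℝ V]
    (A : V ≃ₗ[ℝ] V) (b : LinearMap.BilinForm ℝ V) (x y : V) :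
    pullbackBilin A b x y = b (A x) (A y) := rfl

theorem pullbackFour_apply {V : Type*} [AddCommGroup V] [Module ℝ V]
    (A : V ≃ₗ[ℝ] V) (R : FourForm V) (x y z w : V) :
    pullbackFour A R x y z w = R (A x) (A y) (A z) (A w) := rfl

namespace CurvatureModel

variable {V : Type*} [AddCommGroup V] [Module ℝ V]

/-- A model is Riemannian if its inner product is positive definite. -/
def IsRiemannian (M : CurvatureModel V) : Prop :=
  ∀ x : V, x ≠ 0 → 0 < M.metric x x

/-- The skew-symmetric curvature operator `𝓡(x, y)`; see `metric_curvOp` for its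
characterization. -/
noncomputable def curvOp [FiniteDimensional ℝ V] (M : CurvatureModel V) (x y : V) :
    V →ₗ[ℝ] V :=
  ((M.metric.toDual M.metric_nondegenerate).symm : Module.Dual ℝ V →ₗ[ℝ] V) ∘ₗ M.curv x y

theorem metric_curvOp [FiniteDimensional ℝ V] (M : CurvatureModel V) (x y z w : V) :
    M.metric (M.curvOp x y z) w = M.curv x y z w :=
  LinearMap.BilinForm.apply_toDual_symm_apply (hB := M.metric_nondegenerate) _ _

/-- A model is skew-Tsankov if its skew-symmetric curvature operators commute. -/
def IsSkewTsankov [FiniteDimensional ℝ V] (M : CurvatureModel V) : Prop :=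
  ∀ x y z w : V, M.curvOp x y ∘ₗ M.curvOp z w = M.curvOp z w ∘ₗ M.curvOp x y

/-- The kernel of the curvature tensor. -/
def kerCurv (M : CurvatureModel V) : Submodule ℝ V := LinearMap.ker M.curv

theorem mem_kerCurv (M : CurvatureModel V) (v : V) :
    v ∈ M.kerCurv ↔ ∀ x y z, M.curv v x y z = 0 := by
  constructor
  · intro h x y z
    have h' : M.curv v = 0 := h
    simp [h']
  · intro h
    refine LinearMap.mem_ker.2 ?_
    ext x y z
    exact h x y z

/-- The model `A^* M = (V, A^* φ, A^* R)` for `A ∈ GL(V)`. -/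
noncomputable def pullback (M : CurvatureModel V) (A : V ≃ₗ[ℝ] V) : CurvatureModel V where
  metric := pullbackBilin A M.metric
  metric_symm x y := M.metric_symm (A x) (A y)
  metric_nondegenerate := by
    obtain ⟨h₁, h₂⟩ := M.metric_nondegenerate
    constructor
    · intro x hx
      refine A.map_eq_zero_iff.1 (h₁ (A x) fun y => ?_)
      simpa [pullbackBilin_apply] using hx (A.symm y)
    · intro x hx
      refine A.map_eq_zero_iff.1 (h₂ (A x) fun y => ?_)
      simpa [pullbackBilin_apply] using hx (A.symm y)
  curv := pullbackFour A M.curv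
  curv_algebraic :=
    { antisymm := fun x y z w => M.curv_algebraic.antisymm (A x) (A y) (A z) (A w)
      pair_symm := fun x y z w => M.curv_algebraic.pair_symm (A x) (A y) (A z) (A w)
      bianchi := fun x y z w => M.curv_algebraic.bianchi (A x) (A y) (A z) (A w) }

/-- `A` preserves the tensor with the given label. -/
def Preserves (M : CurvatureModel V) (A : V ≃ₗ[ℝ] V) : TensorLabel → Prop
  | .metric => pullbackBilin A M.metric = M.metric
  | .curv => pullbackFour A M.curv = M.curv

/-- The structure group of the model space `M'` that consists of `V` and the tensors of `M` with
labels in `T`: all elements of `GL(V)` that preserve these tensors. -/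
def structureGroup (M : CurvatureModel V) (T : Set TensorLabel) : Set (V ≃ₗ[ℝ] V) :=
  {A | ∀ t ∈ T, M.Preserves A t}

/-- A `K`-valued function `α` of models on `V` is an invariant of `M`, relative to the model space
`M'` formed by the tensors of `M` with labels in `T`, if its value at `M` does not change under the
action of the structure group of `M'` on the tensors of `M`. -/
def IsInvariant {K : Type*} (M : CurvatureModel V) (T : Set TensorLabel)
    (α : CurvatureModel V → K) : Prop :=
  ∀ A ∈ M.structureGroup T, α (M.pullback A) = α M

/-- A decomposition `M = M₁ ⊕ ⋯ ⊕ Mₛ ⊕ 𝔎` of a model space into `s` two-dimensional summands,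
supported on `plane i`, and a summand with zero curvature, supported on `flat`. -/
structure Decomposition (M : CurvatureModel V) (s : ℕ) where
  /-- the underlying spaces of the two-dimensional summands -/
  plane : Fin s → Submodule ℝ V
  /-- the underlying space of the flat summand -/
  flat : Submodule ℝ V
  finrank_plane : ∀ i, Module.finrank ℝ (plane i) = 2
  isInternal : DirectSum.IsInternal (fun o : Option (Fin s) => o.elim flat plane)
  metric_perp : ∀ o o' : Option (Fin s), o ≠ o' →
    ∀ x ∈ o.elim flat plane, ∀ y ∈ o'.elim flat plane, M.metric x y = 0
  curv_perp : ∀ o o' : Option (Fin s), o ≠ o' →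
    ∀ x ∈ o.elim flat plane, ∀ y ∈ o'.elim flat plane, ∀ z w, M.curv x y z w = 0
  curv_flat : ∀ x ∈ flat, ∀ y ∈ flat, ∀ z ∈ flat, ∀ w ∈ flat, M.curv x y z w = 0

/-- The sectional curvature of the plane spanned by `x` and `y`. -/
noncomputable def sectionalCurvature (M : CurvatureModel V) (x y : V) : ℝ :=
  M.curv x y y x / (M.metric x x * M.metric y y - M.metric x y ^ 2)

namespace Decomposition

variable [FiniteDimensional ℝ V] {M : CurvatureModel V} {s : ℕ}

/-- The sectional curvature `κ i` of the `i`-th two-dimensional summand, computed in some basis of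
its plane; by `curvature_eq` any basis gives the same value. -/
noncomputable def curvature (D : M.Decomposition s) (i : Fin s) : ℝ :=
  M.sectionalCurvature (Module.finBasisOfFinrankEq ℝ (D.plane i) (D.finrank_plane i) 0 : D.plane i)
    (Module.finBasisOfFinrankEq ℝ (D.plane i) (D.finrank_plane i) 1 : D.plane i)

end Decomposition

theorem sectionalCurvature_change (M : CurvatureModel V) (e f : V) (a b c d : ℝ)
    (h : a * d - b * c ≠ 0) :
    M.sectionalCurvature (a • e + b • f) (c • e + d • f) = M.sectionalCurvature e f := by
  have hs := M.metric_symm f e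
  have hR := M.curv_algebraic
  have h1 : ∀ x z w, M.curv x x z w = 0 := fun x z w => by
    have := hR.antisymm x x z w
    linarith
  have h2 : ∀ x y z, M.curv x y z z = 0 := fun x y z => by
    rw [hR.pair_symm, h1]
  have h3 : M.curv f e f e = -M.curv e f f e := by rw [hR.antisymm]
  have h5 : M.curv f e e f = M.curv e f f e := hR.pair_symm f e e f
  have h4 : M.curv e f e f = -M.curv e f f e := by rw [hR.antisymm, h5]
  unfold sectionalCurvature
  have hn : M.curv (a • e + b • f) (c • e + d • f) (c • e + d • f) (a • e + b • f)
      = (a * d - b * c) ^ 2 * M.curv e f f e := by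
    simp only [map_add, map_smul, LinearMap.add_apply, LinearMap.smul_apply, smul_eq_mul,
      h1, h2, h3, h4, h5]
    ring
  have hd : M.metric (a • e + b • f) (a • e + b • f) * M.metric (c • e + d • f) (c • e + d • f)
      - M.metric (a • e + b • f) (c • e + d • f) ^ 2
      = (a * d - b * c) ^ 2 * (M.metric e e * M.metric f f - M.metric e f ^ 2) := by
    simp only [map_add, map_smul, LinearMap.add_apply, LinearMap.smul_apply, smul_eq_mul, hs]
    ring
  rw [hn, hd, mul_div_mul_left _ _ (pow_ne_zero 2 h)]

namespace Decomposition

variable [FiniteDimensional ℝ V] {M : CurvatureModel V} {s : ℕ}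

theorem curvature_eq (D : M.Decomposition s) (i : Fin s)
    (b : Module.Basis (Fin 2) ℝ (D.plane i)) :
    D.curvature i = M.sectionalCurvature (b 0 : D.plane i) (b 1 : D.plane i) := by
  set e := Module.finBasisOfFinrankEq ℝ (D.plane i) (D.finrank_plane i) with he
  have hx : ∀ j, ((b j : D.plane i) : V)
      = e.repr (b j) 0 • ((e 0 : D.plane i) : V) + e.repr (b j) 1 • ((e 1 : D.plane i) : V) := by
    intro j
    have := e.sum_repr (b j)
    rw [Fin.sum_univ_two] at this
    conv_lhs => rw [← this]
    simp
  have hdet : e.repr (b 0) 0 * e.repr (b 1) 1 - e.repr (b 0) 1 * e.repr (b 1) 0 ≠ 0 := by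
    have h := (e.isUnit_det b).ne_zero
    rw [Module.Basis.det_apply, Matrix.det_fin_two] at h
    simp only [Module.Basis.toMatrix_apply] at h
    intro h0
    apply h
    linarith
  rw [hx 0, hx 1, sectionalCurvature_change _ _ _ _ _ _ _ hdet]
  rfl

end Decomposition

/-- The function `α` of models is `F(κ₁, …, κₛ)`: on each Riemannian skew-Tsankov model on `V`, its
value is obtained by applying `F` to the sectional curvatures of the two-dimensional summands of
any decomposition with `s` such summands. -/
def IsCurvatureFunction [FiniteDimensional ℝ V] {K : Type*} {s : ℕ} (F : (Fin s → ℝ) → K)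
    (α : CurvatureModel V → K) : Prop :=
  ∀ N : CurvatureModel V, N.IsRiemannian → N.IsSkewTsankov →
    ∀ E : N.Decomposition s, α N = F E.curvature

end CurvatureModel

/-- Symmetric functions of `s` real variables with values in an arbitrary set. -/
def IsSymmetricFunction {K : Type*} {s : ℕ} (F : (Fin s → ℝ) → K) : Prop :=
  ∀ (σ : Equiv.Perm (Fin s)) (k : Fin s → ℝ), F (k ∘ σ) = F k

/-! For a Riemannian model the curvature operators `A i` are skew-adjoint and commute, so the
products `A i * A j` are self-adjoint and commute. If `v` is a joint eigenvector of these products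
with `A i v ≠ 0`, then every `A j v` is a multiple of `A i v`, and the span of `v` and `A i v` is an
invariant plane. Splitting off such planes from the orthogonal complement of `ker R` gives a
decomposition.

The sectional curvatures of the planes of a decomposition, each taken twice, together with zeros on
the flat summand, are the eigenvalues of the Ricci operator. As the model determines this operator,
decompositions of the same length have the same curvatures up to order, which is what makes a
symmetric function of them well defined. Its invariance holds for the whole of `GL(V)`, because the
preimage of a decomposition under `A` decomposes `A^* M` with the same curvatures. -/

section CommutingFamilies

open Module
open scoped InnerProductSpace

variable {𝕜 E ι : Type*} [RCLike 𝕜] [NormedAddCommGroup E] [InnerProductSpace 𝕜 E]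

theorem exists_joint_eigenvector_of_commute [FiniteDimensional 𝕜 E] {T : ι → End 𝕜 E}
    (hT : ∀ i, (T i).IsSymmetric) (hcomm : ∀ i j, Commute (T i) (T j)) {W : Submodule 𝕜 E}
    (hW : ∀ i, W ∈ (T i).invtSubmodule) (hne : W ≠ ⊥) :
    ∃ v ∈ W, v ≠ 0 ∧ ∀ i, ∃ c : 𝕜, T i v = c • v := by
  have htop := LinearMap.IsSymmetric.iSup_iInf_eq_top_of_commute
    (fun i => (hT i).restrict_invariant (hW i)) fun i j _ => LinearMap.ext fun x =>
      Subtype.ext (LinearMap.congr_fun (hcomm i j).eq (x : E))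
  obtain ⟨χ, hχ⟩ : ∃ χ : ι → 𝕜, ⨅ i, End.eigenspace ((T i).restrict (hW i)) (χ i) ≠ ⊥ := by
    by_contra! h
    simp_rw [h, iSup_bot] at htop
    exact hne (Submodule.subsingleton_iff_eq_bot.1
      ((Submodule.subsingleton_iff 𝕜).1 (subsingleton_of_bot_eq_top htop)))
  obtain ⟨v, hv, hv0⟩ := Submodule.exists_mem_ne_zero_of_ne_bot hχ
  exact ⟨v, v.2, by simpa using hv0, fun i => ⟨χ i, congrArg Subtype.val
    (End.mem_eigenspace_iff.1 ((Submodule.mem_iInf _).1 hv i))⟩⟩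

theorem finrank_span_pair_of_inner_eq_zero {u v : E} (hu : u ≠ 0) (hv : v ≠ 0)
    (h : ⟪u, v⟫_𝕜 = 0) : finrank 𝕜 (Submodule.span 𝕜 {u, v}) = 2 := by
  have hli : LinearIndependent 𝕜 ![u, v] := by
    refine linearIndependent_of_ne_zero_of_inner_eq_zero ?_ fun i j hij => ?_
    · simp [Fin.forall_fin_two, hu, hv]
    · fin_cases i <;> fin_cases j <;> simp_all [inner_eq_zero_symm]
  have h2 := finrank_span_eq_card hli
  rwa [Matrix.range_cons_cons_empty, Fintype.card_fin] at h2

theorem pairwise_isOrtho_option_elim {P : ι → Submodule 𝕜 E} (hP : Pairwise fun k l => P k ⟂ P l)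
    {U : Submodule 𝕜 E} (hU : ⨆ k, P k ⟂ U) :
    Pairwise fun o o' : Option ι => (o.elim U P : Submodule 𝕜 E) ⟂ o'.elim U P := by
  have hPU (k : ι) : P k ⟂ U := hU.mono_left (le_iSup P k)
  rintro (_ | k) (_ | l) h
  exacts [(h rfl).elim, (hPU l).symm, hPU k, hP fun hkl => h (congrArg _ hkl)]

theorem isInternal_option_elim_of_iSup_eq_orthogonal [FiniteDimensional 𝕜 E] [DecidableEq ι]
    {P : ι → Submodule 𝕜 E} (hP : Pairwise fun k l => P k ⟂ P l) {U : Submodule 𝕜 E}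
    (hU : ⨆ k, P k = Uᗮ) :
    DirectSum.IsInternal fun o : Option ι => (o.elim U P : Submodule 𝕜 E) := by
  have hperp := pairwise_isOrtho_option_elim hP (Submodule.isOrtho_iff_le.2 hU.le)
  rw [(OrthogonalFamily.of_pairwise hperp).isInternal_iff, iSup_option]
  simp only [Option.elim_none, Option.elim_some, hU]
  rw [Submodule.sup_orthogonal_of_hasOrthogonalProjection, Submodule.top_orthogonal_eq_bot]

end CommutingFamilies

section CommutingSkewAdjoint

open Module
open scoped InnerProductSpace

variable {E ι : Type*} [NormedAddCommGroup E] [InnerProductSpace ℝ E]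

theorem inner_map_of_isSkewAdjoint {T : End ℝ E} (hT : (innerₗ E).IsSkewAdjoint T) (x y : E) :
    ⟪T x, y⟫_ℝ = -⟪x, T y⟫_ℝ :=
  (hT x y).trans (inner_neg_right _ _)

theorem inner_map_self_of_isSkewAdjoint {T : End ℝ E} (hT : (innerₗ E).IsSkewAdjoint T) (x : E) :
    ⟪x, T x⟫_ℝ = 0 := by
  have h := inner_map_of_isSkewAdjoint hT x x
  rw [real_inner_comm] at h
  linarith

theorem orthogonal_mem_invtSubmodule_of_isSkewAdjoint {T : End ℝ E}
    (hT : (innerₗ E).IsSkewAdjoint T) {P : Submodule ℝ E} (hP : P ∈ T.invtSubmodule) :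
    Pᗮ ∈ T.invtSubmodule := fun x hx u hu => by
  rw [← neg_eq_zero, ← inner_map_of_isSkewAdjoint hT]
  exact hx _ (hP hu)

theorem isSymmetric_mul_of_isSkewAdjoint {S T : End ℝ E} (hS : (innerₗ E).IsSkewAdjoint S)
    (hT : (innerₗ E).IsSkewAdjoint T) (h : Commute S T) : (S * T).IsSymmetric := fun x y => by
  rw [End.mul_apply, inner_map_of_isSkewAdjoint hS, inner_map_of_isSkewAdjoint hT, neg_neg, h.eq,
    End.mul_apply]

variable [FiniteDimensional ℝ E] {A : ι → End ℝ E}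

theorem exists_invariant_plane (hskew : ∀ i, (innerₗ E).IsSkewAdjoint (A i))
    (hcomm : ∀ i j, Commute (A i) (A j)) {W : Submodule ℝ E} (hW : ∀ i, W ∈ (A i).invtSubmodule)
    (hker : W ≤ (⨅ i, LinearMap.ker (A i))ᗮ) (hne : W ≠ ⊥) :
    ∃ P ≤ W, finrank ℝ P = 2 ∧ ∀ i, P ∈ (A i).invtSubmodule := by
  obtain ⟨v, hvW, hv0, hv⟩ := exists_joint_eigenvector_of_commute
    (T := fun p : ι × ι => A p.1 * A p.2)
    (fun p => isSymmetric_mul_of_isSkewAdjoint (hskew _) (hskew _) (hcomm _ _))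
    (fun p q => ((hcomm _ _).mul_right (hcomm _ _)).mul_left ((hcomm _ _).mul_right (hcomm _ _)))
    (fun p _ hx => hW _ (hW _ hx)) hne
  choose c hc using fun i j => hv (i, j)
  simp only [End.mul_apply] at hc
  obtain ⟨i, hi⟩ : ∃ i, A i v ≠ 0 := by
    by_contra! h
    exact hv0 (Submodule.disjoint_def.1 (Submodule.orthogonal_disjoint _) v
      ((Submodule.mem_iInf _).2 h) (hker hvW))
  have hcii : c i i ≠ 0 := fun h0 => hi <| inner_self_eq_zero (𝕜 := ℝ).1 <| by
    rw [inner_map_of_isSkewAdjoint (hskew i), hc, h0, zero_smul, inner_zero_right, neg_zero]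
  have hline (j : ι) : A j v = (c i j / c i i) • A i v := by
    have hswap (x : E) : A j (A i x) = A i (A j x) := LinearMap.congr_fun (hcomm j i).eq x
    have h : c i i • A j v = c i j • A i v := calc
      c i i • A j v = A j (A i (A i v)) := by rw [hc, map_smul]
      _ = A i (A i (A j v)) := by rw [hswap, hswap]
      _ = c i j • A i v := by rw [hc, map_smul]
    rw [div_eq_inv_mul, mul_smul, ← h, inv_smul_smul₀ hcii]
  refine ⟨Submodule.span ℝ {v, A i v}, ?_, finrank_span_pair_of_inner_eq_zero hv0 hi
    (inner_map_self_of_isSkewAdjoint (hskew i) v), fun j => ?_⟩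
  · rw [Submodule.span_le, Set.pair_subset_iff]
    exact ⟨hvW, hW i hvW⟩
  · rw [End.mem_invtSubmodule, Submodule.span_le, Set.pair_subset_iff]
    exact ⟨Submodule.mem_span_pair.2 ⟨0, c i j / c i i, by rw [zero_smul, zero_add, ← hline]⟩,
      Submodule.mem_span_pair.2 ⟨c j i, 0, by rw [hc, zero_smul, add_zero]⟩⟩

theorem exists_orthogonal_invariant_planes (hskew : ∀ i, (innerₗ E).IsSkewAdjoint (A i))
    (hcomm : ∀ i j, Commute (A i) (A j)) {W : Submodule ℝ E} (hW : ∀ i, W ∈ (A i).invtSubmodule)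
    (hker : W ≤ (⨅ i, LinearMap.ker (A i))ᗮ) :
    ∃ (s : ℕ) (P : Fin s → Submodule ℝ E), (∀ k, finrank ℝ (P k) = 2) ∧
      (∀ k i, P k ∈ (A i).invtSubmodule) ∧ Pairwise (fun k l => P k ⟂ P l) ∧ ⨆ k, P k = W := by
  induction hn : finrank ℝ W using Nat.strong_induction_on generalizing W with
  | _ n ih =>
  subst hn
  rcases eq_or_ne W ⊥ with rfl | hne
  · exact ⟨0, Fin.elim0, nofun, nofun, nofun, by simp⟩
  obtain ⟨P₀, hP₀W, hP₀, hinv₀⟩ := exists_invariant_plane hskew hcomm hW hker hne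
  have hsup : P₀ ⊔ P₀ᗮ ⊓ W = W := Submodule.sup_orthogonal_inf_of_hasOrthogonalProjection hP₀W
  have hlt : finrank ℝ (P₀ᗮ ⊓ W : Submodule ℝ E) < finrank ℝ W := by
    have h := Submodule.finrank_add_inf_finrank_orthogonal hP₀W
    omega
  obtain ⟨s, P, hP, hinv, hperp, hiSup⟩ := ih _ hlt
    (fun i => End.invtSubmodule.inf_mem
      (orthogonal_mem_invtSubmodule_of_isSkewAdjoint (hskew i) (hinv₀ i)) (hW i))
    (inf_le_right.trans hker) rfl
  have hperp₀ (k : Fin s) : P k ⟂ P₀ :=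
    Submodule.isOrtho_iff_le.2 ((le_iSup P k).trans (hiSup.trans_le inf_le_left))
  refine ⟨s + 1, Fin.cons P₀ P, Fin.cases hP₀ hP, Fin.cases hinv₀ hinv, ?_, ?_⟩
  · refine Fin.cases (Fin.cases (fun h => (h rfl).elim) fun l _ => (hperp₀ l).symm) fun k =>
      Fin.cases (fun _ => hperp₀ k) fun l h => hperp fun hkl => h (congrArg _ hkl)
  · rw [← sSup_range, Fin.range_cons, sSup_insert, sSup_range, hiSup, hsup]

end CommutingSkewAdjoint

section LinearAlgebra

open Module Polynomial

theorem le_span_pair_of_basis {R V : Type*} [Semiring R] [AddCommMonoid V]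
    [Module R V] {P : Submodule R V} (b : Basis (Fin 2) R P) :
    P ≤ Submodule.span R {(b 0 : V), (b 1 : V)} := fun v hv =>
  Submodule.mem_span_pair.2 ⟨b.repr ⟨v, hv⟩ 0, b.repr ⟨v, hv⟩ 1, by
    simpa [Fin.sum_univ_two, -Basis.sum_repr] using congrArg Subtype.val (b.sum_repr ⟨v, hv⟩)⟩

variable {K V : Type*} [Field K] [AddCommGroup V] [Module K V]

theorem charpoly_eq_prod_of_isInternal [FiniteDimensional K V] {ι : Type*} [Fintype ι]
    [DecidableEq ι] {N : ι → Submodule K V} (hN : DirectSum.IsInternal N) {T : End K V}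
    {c : ι → K} (hT : ∀ i, ∀ x ∈ N i, T x = c i • x) :
    T.charpoly = ∏ i, (X - C (c i)) ^ finrank K (N i) := by
  let b := hN.collectedBasis fun i => finBasis K (N i)
  have hdiag : LinearMap.toMatrix b b T = Matrix.diagonal fun p => c p.1 := by
    ext p q
    rw [LinearMap.toMatrix_apply, hT q.1 _ (hN.collectedBasis_mem _ q), map_smul, b.repr_self,
      Finsupp.smul_apply, Finsupp.single_apply, Matrix.diagonal_apply]
    rcases eq_or_ne p q with rfl | h
    · simp
    · simp [h, h.symm]
  rw [← LinearMap.charpoly_toMatrix T b, hdiag, Matrix.charpoly_diagonal, Fintype.prod_sigma]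
  simp only [Finset.prod_const, Finset.card_univ, Fintype.card_fin]

theorem exists_perm_of_map_univ_eq {ι α : Type*} [Fintype ι] {k l : ι → α}
    (h : Finset.univ.val.map k = Finset.univ.val.map l) : ∃ σ : Equiv.Perm ι, k = l ∘ σ := by
  classical
  have hcard (c : α) : Fintype.card {i // k i = c} = Fintype.card {i // l i = c} := by
    have hcount := congrArg (Multiset.count c) h
    simpa only [Multiset.count_map, ← Finset.filter_val, Finset.card_val, eq_comm (a := c),
      ← Fintype.card_subtype] using hcount
  exact ⟨Equiv.ofFiberEquiv fun c => Fintype.equivOfCardEq (hcard c),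
    funext fun i => (Equiv.ofFiberEquiv_map _ i).symm⟩

theorem exists_perm_of_prod_X_sub_C_pow_eq {ι : Type*} [Fintype ι] {k l : ι → K} {n : ℕ}
    (hn : n ≠ 0) (h : (∏ i, (X - C (k i))) ^ n = (∏ i, (X - C (l i))) ^ n) :
    ∃ σ : Equiv.Perm ι, k = l ∘ σ := by
  have hroots (k : ι → K) : ((∏ i, (X - C (k i))) ^ n).roots = n • Finset.univ.val.map k := by
    rw [roots_pow, roots_prod _ _ (Finset.prod_ne_zero_iff.2 fun i _ => X_sub_C_ne_zero _)]
    simp only [roots_X_sub_C, Multiset.bind_singleton]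
  exact exists_perm_of_map_univ_eq (nsmul_right_injective hn
    ((hroots k).symm.trans ((congrArg roots h).trans (hroots l))))

end LinearAlgebra

namespace CurvatureModel

open Module

variable {V : Type*} [AddCommGroup V] [Module ℝ V] (M : CurvatureModel V)

theorem metric_left_injective : Function.Injective M.metric :=
  LinearMap.separatingLeft_iff_ker_eq_bot.1 M.metric_nondegenerate.1 |> LinearMap.ker_eq_bot.1

theorem curv_antisymm_right (x y z w : V) : M.curv x y z w = -M.curv x y w z := by
  rw [M.curv_algebraic.pair_symm, M.curv_algebraic.antisymm, M.curv_algebraic.pair_symm]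

theorem curv_self_left (x z w : V) : M.curv x x z w = 0 :=
  self_eq_neg.1 (M.curv_algebraic.antisymm x x z w)

theorem curv_self_right (x y z : V) : M.curv x y z z = 0 :=
  self_eq_neg.1 (M.curv_antisymm_right x y z z)

section Existence

variable {M} [FiniteDimensional ℝ V]

/-- The inner product structure of a Riemannian model. -/
abbrev IsRiemannian.innerProductSpaceCore (hM : M.IsRiemannian) : InnerProductSpace.Core ℝ V where
  inner x y := M.metric x y
  conj_inner_symm x y := M.metric_symm y x
  re_inner_nonneg x := by
    rcases eq_or_ne x 0 with rfl | hx
    · simp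
    · exact (hM x hx).le
  definite x := not_imp_not.1 fun hx => (hM x hx).ne'
  add_left x y z := by simp
  smul_left x y r := by simp

variable (M) in
theorem isSkewAdjoint_curvOp (x y : V) : M.metric.IsSkewAdjoint (M.curvOp x y) := fun z w => by
  rw [Pi.neg_apply, map_neg, M.metric_symm z, metric_curvOp, metric_curvOp, curv_antisymm_right]

variable (M) in
theorem kerCurv_eq_iInf_ker_curvOp :
    M.kerCurv = ⨅ p : V × V, LinearMap.ker (M.curvOp p.1 p.2) := by
  ext v
  simp only [mem_kerCurv, Submodule.mem_iInf, LinearMap.mem_ker, Prod.forall]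
  constructor
  · intro h x y
    refine M.metric_left_injective (LinearMap.ext fun w => ?_)
    rw [metric_curvOp, M.curv_algebraic.pair_symm, h, map_zero, LinearMap.zero_apply]
  · intro h x y z
    rw [M.curv_algebraic.pair_symm, ← metric_curvOp, h, map_zero, LinearMap.zero_apply]

theorem IsRiemannian.exists_decomposition (hM : M.IsRiemannian) (hT : M.IsSkewTsankov) :
    ∃ (s : ℕ) (D : M.Decomposition s), D.flat = M.kerCurv := by
  let := hM.innerProductSpaceCore.toNormedAddCommGroup
  let := InnerProductSpace.ofCore hM.innerProductSpaceCore.toCore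
  have hskew (p : V × V) : (innerₗ V).IsSkewAdjoint (M.curvOp p.1 p.2) :=
    M.isSkewAdjoint_curvOp p.1 p.2
  have hker := M.kerCurv_eq_iInf_ker_curvOp
  have hker_inv (p : V × V) : M.kerCurv ∈ End.invtSubmodule (M.curvOp p.1 p.2) := fun x hx => by
    rw [hker, Submodule.mem_iInf] at hx
    rw [Submodule.mem_comap, hx p]
    exact M.kerCurv.zero_mem
  obtain ⟨s, P, hP, hinv, hperp, hsup⟩ := exists_orthogonal_invariant_planes hskew
    (fun p q => hT p.1 p.2 q.1 q.2)
    (fun p => orthogonal_mem_invtSubmodule_of_isSkewAdjoint (hskew p) (hker_inv p))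
    (Submodule.orthogonal_le hker.ge)
  have horth := pairwise_isOrtho_option_elim hperp (Submodule.isOrtho_iff_le.2 hsup.le)
  have hinner (o o' : Option (Fin s)) (h : o ≠ o') :
      ∀ x ∈ o.elim M.kerCurv P, ∀ y ∈ o'.elim M.kerCurv P, M.metric x y = 0 :=
    Submodule.isOrtho_iff_inner_eq.1 (horth h)
  have hinv' (o : Option (Fin s)) (z w : V) :
      ∀ x ∈ o.elim M.kerCurv P, M.curvOp z w x ∈ o.elim M.kerCurv P := by
    cases o with
    | none => exact fun x hx => hker_inv (z, w) hx
    | some k => exact fun x hx => hinv k (z, w) hx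
  exact ⟨s,
    { plane := P
      flat := M.kerCurv
      finrank_plane := hP
      isInternal := isInternal_option_elim_of_iSup_eq_orthogonal hperp hsup
      metric_perp := hinner
      curv_perp := fun o o' h x hx y hy z w => by
        rw [M.curv_algebraic.pair_symm, ← metric_curvOp]
        exact hinner o o' h _ (hinv' o z w x hx) y hy
      curv_flat := fun x hx y _ z _ w _ => (M.mem_kerCurv x).1 hx y z w }, rfl⟩

end Existence

theorem curv_mul_gram {e f x y z w : V} (hx : x ∈ Submodule.span ℝ {e, f})
    (hy : y ∈ Submodule.span ℝ {e, f}) (hz : z ∈ Submodule.span ℝ {e, f})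
    (hw : w ∈ Submodule.span ℝ {e, f}) :
    M.curv x y z w * (M.metric e e * M.metric f f - M.metric e f ^ 2) =
      M.curv e f f e * (M.metric x w * M.metric y z - M.metric x z * M.metric y w) := by
  rw [Submodule.mem_span_pair] at hx hy hz hw
  obtain ⟨x₁, x₂, rfl⟩ := hx
  obtain ⟨y₁, y₂, rfl⟩ := hy
  obtain ⟨z₁, z₂, rfl⟩ := hz
  obtain ⟨w₁, w₂, rfl⟩ := hw
  simp only [map_add, map_smul, LinearMap.add_apply, LinearMap.smul_apply, smul_eq_mul,
    curv_self_left, curv_self_right, M.curv_algebraic.antisymm f e, M.curv_antisymm_right e f e f,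
    M.metric_symm f e]
  ring

theorem gram_ne_zero {P : Submodule ℝ V} (hP : (M.metric.restrict P).Nondegenerate)
    (b : Basis (Fin 2) ℝ P) :
    M.metric (b 0) (b 0) * M.metric (b 1) (b 1) - M.metric (b 0) (b 1) ^ 2 ≠ 0 := by
  have h := (LinearMap.BilinForm.nondegenerate_iff_det_ne_zero b).1 hP
  simpa only [Matrix.det_fin_two, LinearMap.BilinForm.toMatrix_apply,
    LinearMap.BilinForm.restrict_apply, LinearMap.domRestrict_apply, M.metric_symm (b 1) (b 0),
    ← sq] using h

namespace Decomposition

variable {M} {s t : ℕ} (D : M.Decomposition s)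

/-- The summands of a decomposition; the flat one has index `none`. -/
abbrev summand (o : Option (Fin s)) : Submodule ℝ V := o.elim D.flat D.plane

/-- The sum of the summands other than the given one. -/
abbrev others (o : Option (Fin s)) : Submodule ℝ V := ⨆ o' ≠ o, D.summand o'

theorem isCompl_others (o : Option (Fin s)) : IsCompl (D.summand o) (D.others o) :=
  ⟨D.isInternal.submodule_iSupIndep o, codisjoint_iff.2
    ((iSup_split_single D.summand o).symm.trans D.isInternal.submodule_iSup_eq_top)⟩

theorem metric_others {o : Option (Fin s)} {x y : V} (hx : x ∈ D.summand o)
    (hy : y ∈ D.others o) : M.metric x y = 0 := by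
  have h : D.others o ≤ LinearMap.ker (M.metric x) :=
    iSup₂_le fun o' ho' y hy => D.metric_perp o o' ho'.symm x hx y hy
  exact h hy

theorem curv_others {o : Option (Fin s)} {x y : V} (hx : x ∈ D.summand o) (hy : y ∈ D.others o) :
    M.curv x y = 0 := by
  have h : D.others o ≤ LinearMap.ker (M.curv x) := iSup₂_le fun o' ho' y hy => by
    ext z w
    exact D.curv_perp o o' ho'.symm x hx y hy z w
  exact h hy

theorem curv_others_right {o : Option (Fin s)} {x y z : V} (hx : x ∈ D.summand o)
    (hy : y ∈ D.summand o) (hz : z ∈ D.others o) (w : V) : M.curv x y z w = 0 := by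
  have h := M.curv_algebraic.bianchi x y w z
  rw [M.curv_antisymm_right, D.curv_others hx hz, M.curv_algebraic.pair_symm x w,
    M.curv_algebraic.antisymm z y, D.curv_others hy hz] at h
  simpa using h

/-- The projection to a summand along the other ones. -/
noncomputable def proj (o : Option (Fin s)) : V →ₗ[ℝ] V :=
  (D.summand o).projection (D.others o) (D.isCompl_others o)

theorem isProj_proj (o : Option (Fin s)) : LinearMap.IsProj (D.summand o) (D.proj o) :=
  ⟨Submodule.projection_apply_mem _, fun _ => Submodule.projection_apply_of_mem_left _⟩

theorem sub_proj_mem (o : Option (Fin s)) (x : V) : x - D.proj o x ∈ D.others o :=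
  Submodule.sub_projection_mem _ x

theorem metric_proj {o : Option (Fin s)} {x : V} (hx : x ∈ D.summand o) (y : V) :
    M.metric x (D.proj o y) = M.metric x y := by
  rw [eq_comm, ← sub_eq_zero, ← map_sub, D.metric_others hx (D.sub_proj_mem o y)]

theorem curv_proj {o : Option (Fin s)} {x : V} (hx : x ∈ D.summand o) (y z w : V) :
    M.curv x (D.proj o y) (D.proj o z) (D.proj o w) = M.curv x y z w := by
  have hp := (D.isProj_proj o).map_mem
  have hy : M.curv x (D.proj o y) = M.curv x y := by
    conv_rhs => rw [← add_sub_cancel (D.proj o y) y, map_add,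
      D.curv_others hx (D.sub_proj_mem o y), add_zero]
  have hz (z w : V) : M.curv x (D.proj o y) (D.proj o z) w = M.curv x (D.proj o y) z w := by
    rw [eq_comm, ← sub_eq_zero, ← LinearMap.sub_apply, ← map_sub,
      D.curv_others_right hx (hp y) (D.sub_proj_mem o z)]
  rw [hz, M.curv_antisymm_right, hz, ← M.curv_antisymm_right, hy]

theorem flat_le_kerCurv : D.flat ≤ M.kerCurv := fun x (hx : x ∈ D.summand none) =>
  (M.mem_kerCurv x).2 fun y z w => by
    have hp := (D.isProj_proj none).map_mem
    rw [← D.curv_proj hx]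
    exact D.curv_flat x hx _ (hp y) _ (hp z) _ (hp w)

theorem nondegenerate_restrict_metric (o : Option (Fin s)) :
    (M.metric.restrict (D.summand o)).Nondegenerate := by
  have hsymm : LinearMap.IsSymm (M.metric.restrict (D.summand o)) :=
    ⟨fun x y => M.metric_symm x y⟩
  refine hsymm.isRefl.nondegenerate_iff_separatingLeft.2 fun x hx => Subtype.ext ?_
  refine M.metric_nondegenerate.1 x fun y => ?_
  rw [← D.metric_proj x.2]
  exact hx ⟨D.proj o y, (D.isProj_proj o).map_mem y⟩

theorem finrank_eq [FiniteDimensional ℝ V] : finrank ℝ V = finrank ℝ D.flat + 2 * s := by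
  rw [← (LinearEquiv.ofBijective (DirectSum.coeLinearMap D.summand) D.isInternal).finrank_eq,
    finrank_directSum, Fintype.sum_option]
  change finrank ℝ D.flat + ∑ i, finrank ℝ (D.plane i) = _
  simp only [D.finrank_plane, Finset.sum_const, Finset.card_univ, Fintype.card_fin, smul_eq_mul,
    mul_comm]

theorem length_eq [FiniteDimensional ℝ V] (D : M.Decomposition s) (E : M.Decomposition t)
    (h : D.flat = E.flat) : s = t := by
  have hrank := D.finrank_eq.symm.trans E.finrank_eq
  rw [h] at hrank
  omega

variable [FiniteDimensional ℝ V]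

theorem curv_plane {i : Fin s} {x y z w : V} (hx : x ∈ D.plane i) (hy : y ∈ D.plane i)
    (hz : z ∈ D.plane i) (hw : w ∈ D.plane i) :
    M.curv x y z w = D.curvature i *
      (M.metric x w * M.metric y z - M.metric x z * M.metric y w) := by
  let b := finBasisOfFinrankEq ℝ (D.plane i) (D.finrank_plane i)
  have hgram := M.gram_ne_zero (D.nondegenerate_restrict_metric (some i)) b
  have hspan := le_span_pair_of_basis b
  have h := M.curv_mul_gram (hspan hx) (hspan hy) (hspan hz) (hspan hw)
  rw [eq_div_of_mul_eq hgram h, mul_div_right_comm]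
  rfl

end Decomposition

section Ricci

open Polynomial

variable [FiniteDimensional ℝ V]

/-- The curvature operator `𝓡(x, y)` as a bilinear map in `x` and `y`. -/
noncomputable def curvOpHom : V →ₗ[ℝ] V →ₗ[ℝ] V →ₗ[ℝ] V :=
  M.curv.compr₂ (LinearMap.compRight ℝ (M.metric.toDual M.metric_nondegenerate).symm.toLinearMap)

/-- The Ricci tensor `ρ(x, w) = tr (y ↦ 𝓡(y, x) w)`. -/
noncomputable def ricci : LinearMap.BilinForm ℝ V :=
  (LinearMap.lflip.toLinearMap ∘ₗ M.curvOpHom.flip).compr₂ (LinearMap.trace ℝ V)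

/-- The Ricci operator: the endomorphism corresponding to the Ricci tensor under the metric. -/
noncomputable def ricciOp : V →ₗ[ℝ] V :=
  (M.metric.toDual M.metric_nondegenerate).symm.toLinearMap ∘ₗ M.ricci

theorem metric_ricciOp (x w : V) :
    M.metric (M.ricciOp x) w = LinearMap.trace ℝ V ((M.curvOpHom.flip x).flip w) :=
  LinearMap.BilinForm.apply_toDual_symm_apply (hB := M.metric_nondegenerate) _ _

theorem metric_curvOpHom_flip (x w y u : V) :
    M.metric ((M.curvOpHom.flip x).flip w y) u = M.curv y x w u :=
  M.metric_curvOp y x w u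

variable {M} in
theorem ricciOp_of_mem_kerCurv {x : V} (hx : x ∈ M.kerCurv) : M.ricciOp x = 0 := by
  refine M.metric_left_injective (LinearMap.ext fun w => ?_)
  have hzero : (M.curvOpHom.flip x).flip w = 0 :=
    LinearMap.ext fun y => M.metric_left_injective <| LinearMap.ext fun u => by
      rw [metric_curvOpHom_flip, M.curv_algebraic.antisymm, (M.mem_kerCurv x).1 hx, neg_zero,
        LinearMap.zero_apply, map_zero, LinearMap.zero_apply]
  rw [metric_ricciOp, hzero, map_zero, map_zero, LinearMap.zero_apply]

namespace Decomposition

variable {M} {s : ℕ} (D : M.Decomposition s)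

theorem curvOpHom_flip_plane {i : Fin s} {x : V} (hx : x ∈ D.plane i) (w : V) :
    (M.curvOpHom.flip x).flip w =
      D.curvature i • (M.metric x w • D.proj (some i) -
        (M.metric w ∘ₗ D.proj (some i)).smulRight x) := by
  refine LinearMap.ext fun y => M.metric_left_injective (LinearMap.ext fun u => ?_)
  have hx' : x ∈ D.summand (some i) := hx
  have hp := (D.isProj_proj (some i)).map_mem
  rw [metric_curvOpHom_flip, M.curv_algebraic.antisymm, ← D.curv_proj hx',
    D.curv_plane hx (hp y) (hp w) (hp u), D.metric_proj hx', D.metric_proj hx',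
    D.metric_proj (hp y), D.metric_proj (hp y), M.metric_symm _ w]
  simp only [LinearMap.smul_apply, LinearMap.sub_apply, LinearMap.smulRight_apply,
    LinearMap.comp_apply, map_smul, map_sub, smul_eq_mul]
  ring

theorem ricciOp_plane {i : Fin s} {x : V} (hx : x ∈ D.plane i) :
    M.ricciOp x = D.curvature i • x := by
  refine M.metric_left_injective (LinearMap.ext fun w => ?_)
  have htrace : LinearMap.trace ℝ V (D.proj (some i)) = 2 := by
    rw [(D.isProj_proj (some i)).trace]
    exact congrArg Nat.cast (D.finrank_plane i)
  rw [metric_ricciOp, D.curvOpHom_flip_plane hx, map_smul, map_sub, map_smul, htrace,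
    LinearMap.trace_smulRight, LinearMap.comp_apply, (D.isProj_proj (some i)).map_id x hx,
    M.metric_symm w, map_smul, LinearMap.smul_apply]
  simp only [smul_eq_mul]
  ring

theorem charpoly_ricciOp :
    M.ricciOp.charpoly = X ^ finrank ℝ D.flat * (∏ i, (X - C (D.curvature i))) ^ 2 := by
  have hsmul (o : Option (Fin s)) : ∀ x ∈ D.summand o,
      M.ricciOp x = (o.elim 0 D.curvature : ℝ) • x := by
    cases o with
    | none => exact fun x hx =>
        (ricciOp_of_mem_kerCurv (D.flat_le_kerCurv hx)).trans (zero_smul ℝ x).symm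
    | some i => exact fun x => D.ricciOp_plane
  rw [charpoly_eq_prod_of_isInternal D.isInternal hsmul, Fintype.prod_option]
  change (X - C 0) ^ finrank ℝ D.flat * ∏ i, (X - C (D.curvature i)) ^ finrank ℝ (D.plane i) = _
  simp only [D.finrank_plane, Finset.prod_pow, C_0, sub_zero]

theorem exists_perm_curvature (D E : M.Decomposition s) :
    ∃ σ : Equiv.Perm (Fin s), D.curvature = E.curvature ∘ σ := by
  have hflat : finrank ℝ D.flat = finrank ℝ E.flat :=
    Nat.add_right_cancel (D.finrank_eq.symm.trans E.finrank_eq)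
  have h := D.charpoly_ricciOp.symm.trans E.charpoly_ricciOp
  rw [hflat] at h
  exact exists_perm_of_prod_X_sub_C_pow_eq two_ne_zero
    (mul_left_cancel₀ (pow_ne_zero _ X_ne_zero) h)

end Decomposition

end Ricci

section Pullback

variable {M}

theorem IsRiemannian.pullback (hM : M.IsRiemannian) (A : V ≃ₗ[ℝ] V) :
    (M.pullback A).IsRiemannian :=
  fun x hx => hM (A x) (A.map_ne_zero_iff.2 hx)

variable (M) in
theorem curvOp_pullback [FiniteDimensional ℝ V] (A : V ≃ₗ[ℝ] V) (x y z : V) :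
    A ((M.pullback A).curvOp x y z) = M.curvOp (A x) (A y) (A z) := by
  refine M.metric_left_injective (LinearMap.ext fun w => ?_)
  obtain ⟨w, rfl⟩ := A.surjective w
  rw [metric_curvOp]
  exact (M.pullback A).metric_curvOp x y z w

theorem IsSkewTsankov.pullback [FiniteDimensional ℝ V] (hM : M.IsSkewTsankov)
    (A : V ≃ₗ[ℝ] V) : (M.pullback A).IsSkewTsankov := fun x y z w => by
  refine LinearMap.ext fun v => A.injective ?_
  simp only [LinearMap.comp_apply, curvOp_pullback]
  exact LinearMap.congr_fun (hM (A x) (A y) (A z) (A w)) (A v)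

namespace Decomposition

variable {s : ℕ} (D : M.Decomposition s) (A : V ≃ₗ[ℝ] V)

/-- The decomposition of `A^* M` into the preimages under `A` of the summands of `D`. -/
def pullback : (M.pullback A).Decomposition s where
  plane i := (D.plane i).comap A.toLinearMap
  flat := D.flat.comap A.toLinearMap
  finrank_plane i := by
    rw [← D.finrank_plane i, Submodule.comap_equiv_eq_map_symm]
    exact LinearEquiv.finrank_map_eq A.symm (D.plane i)
  isInternal := by
    have h := D.isInternal
    rw [DirectSum.isInternal_submodule_iff_iSupIndep_and_iSup_eq_top] at h ⊢
    have hcomap : (fun o : Option (Fin s) => o.elim (D.flat.comap A.toLinearMap)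
        fun i => (D.plane i).comap A.toLinearMap) =
        (Submodule.orderIsoMapComap A).symm ∘ D.summand := by
      funext o
      cases o <;> rfl
    rw [hcomap, iSupIndep_map_orderIso_iff]
    refine ⟨h.1, ?_⟩
    rw [← (Submodule.orderIsoMapComap A).symm.map_top, ← h.2, OrderIso.map_iSup]
    rfl
  metric_perp := by
    rintro (_ | i) (_ | j) h x hx y hy <;> exact D.metric_perp _ _ h (A x) hx (A y) hy
  curv_perp := by
    rintro (_ | i) (_ | j) h x hx y hy z w <;>
      exact D.curv_perp _ _ h (A x) hx (A y) hy (A z) (A w)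
  curv_flat x hx y hy z hz w hw := D.curv_flat (A x) hx (A y) hy (A z) hz (A w) hw

theorem curvature_pullback [FiniteDimensional ℝ V] :
    (D.pullback A).curvature = D.curvature := by
  funext i
  let e : (D.pullback A).plane i ≃ₗ[ℝ] D.plane i :=
    A.ofSubmodules _ _ (Submodule.map_comap_eq_of_surjective A.surjective (D.plane i))
  let b := finBasisOfFinrankEq ℝ _ ((D.pullback A).finrank_plane i)
  rw [D.curvature_eq i (b.map e)]
  rfl

end Decomposition

end Pullback

section Invariants

variable {M} [FiniteDimensional ℝ V] {K : Type*} {s : ℕ} {F : (Fin s → ℝ) → K}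

theorem exists_isCurvatureFunction (hF : IsSymmetricFunction F) :
    ∃ α : CurvatureModel V → K, IsCurvatureFunction F α := by
  classical
  refine ⟨fun N => F (if h : Nonempty (N.Decomposition s) then h.some.curvature else 0),
    fun N _ _ E => ?_⟩
  have h : Nonempty (N.Decomposition s) := ⟨E⟩
  obtain ⟨σ, hσ⟩ := h.some.exists_perm_curvature E
  exact (congrArg F ((dif_pos h).trans hσ)).trans (hF σ _)

theorem IsCurvatureFunction.isInvariant {α : CurvatureModel V → K} (hα : IsCurvatureFunction F α)
    (hM : M.IsRiemannian) (hT : M.IsSkewTsankov) (D : M.Decomposition s) (T : Set TensorLabel) :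
    M.IsInvariant T α := fun A _ => by
  rw [hα M hM hT D, hα _ (hM.pullback A) (hT.pullback A) (D.pullback A), D.curvature_pullback]

end Invariants

end CurvatureModel

theorem theorem5p3 {V : Type*} [AddCommGroup V] [Module ℝ V] [FiniteDimensional ℝ V] (K : Type*)
    (M : CurvatureModel V) (hM : M.IsRiemannian) (hT : M.IsSkewTsankov) :
    (∃ (s : ℕ) (D : M.Decomposition s), D.flat = M.kerCurv) ∧
    (∀ (s t : ℕ) (D : M.Decomposition s) (E : M.Decomposition t),
      D.flat = M.kerCurv → E.flat = M.kerCurv → s = t) ∧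
    (∀ (s : ℕ) (_ : M.Decomposition s) (F : (Fin s → ℝ) → K), IsSymmetricFunction F →
      (∃ α : CurvatureModel V → K, CurvatureModel.IsCurvatureFunction F α) ∧
      ∀ α : CurvatureModel V → K, CurvatureModel.IsCurvatureFunction F α →
        ∀ T : Set TensorLabel, M.IsInvariant T α) := by
  exact ⟨hM.exists_decomposition hT, fun s t D E hD hE => D.length_eq E (hD.trans hE.symm),
    fun s D F hF => ⟨CurvatureModel.exists_isCurvatureFunction hF,
      fun α hα T => hα.isInvariant hM hT D T⟩⟩
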